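/- Let $\mathbb F_q$ be a finite field, and measure all entropies in base $q$. Two databases store the same $K$ messages $W_1,\dots,W_K$, each consisting of $L\ge 1$ symbols, all $KL$ symbols being i.i.d. uniform on $\mathbb F_q$, and they share a common randomness $\mathcal S$ (a random variable with finite alphabet and arbitrary law) that is independent of the messages. A two-database scheme consists of finite nonempty families of answers $A_1,\dots,A_{M_1}$ (database 1) and $B_1,\dots,B_{M_2}$ (database 2), each with values in a finite alphabet and each a deterministic function of $(W_{1:K},\mathcal S)$; the databases independently choose uniform indices $a\in[M_1]$, $b\in[M_2]$ and send $A_a$ and $B_b$ to the user. The scheme is a *valid* scheme for random symmetric private information retrieval (RSPIR) if there are indices $\theta_{a,b}\in[K]$ such that * (random reliability) $H(W_{\theta_{a,b}}\mid A_a,B_b)=0$ for all $a,b$; * (database privacy) $I\big((W_j)_{j\ne\theta_{a,b}};A_a,B_b\big)=0$ for all $a,b$; * (user privacy) for every fixed $a$, when $b$ is uniform on $[M_2]$ the index $\theta_{a,b}$ is uniform on $[K]$, and for every fixed $b$, when $a$ is uniform on $[M_1]$ the index $\theta_{a,b}$ is uniform on $[K]$. The download cost $D$ of a scheme is the maximum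 over $(a,b)$ of the number of $q$-ary symbols in $(A_a,B_b)$, that is, of $\log_q|\mathrm{supp}\,A_a|+\log_q|\mathrm{supp}\,B_b|$. The retrieval rate is $L/D$, and the capacity for $K$ messages over $\mathbb F_q$ is the supremum of $L/D$ over all valid schemes with any $L\ge1$. **Theorem.** For $K=2$ the capacity is $C=\tfrac12$ and the minimal amount of common randomness is $L$; for $K=3$ and for $K=4$ the capacity is $C=\tfrac13$ and the minimal amount of common randomness is $2L$. Precisely, put $\rho=1$ for $K=2$, $\rho=2$ for $K=3,4$, and $\ell=1$ for $K=2,3$, $\ell=2$ for $K=4$. Then for every finite field $\mathbb F_q$: 1. the capacity is $C$; the supremum of the rates is also $C$ if $D$ is replaced by $D+\log_q M_1+\log_q M_2$ (the answer indices are charged too), and if $D$ is replaced by $\max_{a,b}\big(H(A_a)+H(B_b)\big)$; 2. every valid scheme, of any message length $L\ge 1$, satisfies $H(\mathcal S)\ge\rho L$; 3. for every $L\ge1$ divisible by $\ell$ there is a valid scheme of message length $L$ with $L/D=C$ and $H(\mathcal S)=\rho L$. -/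

import Mathlib

universe u

noncomputable section

namespace RSPIR

/-! ### Shannon quantities of finitely-valued random variables

A random variable on the probability space `(Ω, P)` is a function `X : Ω → α`; its law is `P.map X`.
All quantities are measured in base `q`. -/

/-- The Shannon entropy `H(p) = - ∑ x, p(x) log_q p(x)` of a law on a finite type. -/
def lawEntropy (q : ℝ) {α : Type*} [Fintype α] (p : PMF α) : ℝ :=
  ∑ x, Real.negMulLog (p x).toReal / Real.log q

/-- The entropy `H(X)`. -/
def entropy (q : ℝ) {Ω α : Type*} [Fintype α] (P : PMF Ω) (X : Ω → α) : ℝ :=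
  lawEntropy q (P.map X)

/-- The conditional entropy `H(X | Y) = H(X, Y) - H(Y)`. -/
def condEntropy (q : ℝ) {Ω α β : Type*} [Fintype α] [Fintype β] (P : PMF Ω)
    (X : Ω → α) (Y : Ω → β) : ℝ :=
  entropy q P (fun ω => (X ω, Y ω)) - entropy q P Y

/-- The mutual information `I(X; Y) = H(X) + H(Y) - H(X, Y)`. -/
def mutualInfo (q : ℝ) {Ω α β : Type*} [Fintype α] [Fintype β] (P : PMF Ω)
    (X : Ω → α) (Y : Ω → β) : ℝ :=
  entropy q P X + entropy q P Y - entropy q P (fun ω => (X ω, Y ω))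

/-! ### Two-database schemes -/

/-- The message sets: `K` messages, each a string of `L` symbols of `F`. -/
abbrev Messages (F : Type u) (K L : ℕ) : Type u := Fin K → Fin L → F

/-- A two-database scheme for `K` messages of length `L` over `F`: the common randomness (a random
variable with finite alphabet and an arbitrary law), and for each database a finite nonempty
indexed family of answers, each a deterministic function of the messages and of the common
randomness. -/
structure Scheme (F : Type u) (K L : ℕ) where
  /-- the alphabet of the common randomness -/
  Rand : Type u
  [fintypeRand : Fintype Rand]
  /-- the law of the common randomness -/
  law : PMF Rand
  /-- the number of answers of database 1 -/
  M₁ : ℕ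
  /-- the number of answers of database 2 -/
  M₂ : ℕ
  M₁_pos : 0 < M₁
  M₂_pos : 0 < M₂
  /-- the alphabet in which the answers of database 1 are written -/
  AlphA : Type u
  [fintypeAlphA : Fintype AlphA]
  /-- the alphabet in which the answers of database 2 are written -/
  AlphB : Type u
  [fintypeAlphB : Fintype AlphB]
  /-- the answers of database 1 -/
  ansA : Fin M₁ → Messages F K L → Rand → AlphA
  /-- the answers of database 2 -/
  ansB : Fin M₂ → Messages F K L → Rand → AlphB

attribute [instance] Scheme.fintypeRand Scheme.fintypeAlphA Scheme.fintypeAlphB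

namespace Scheme

variable {F : Type u} [Field F] [Fintype F] {K L : ℕ}

/-- The sample space: a message set together with a value of the common randomness. -/
abbrev Sample (T : Scheme F K L) : Type u := Messages F K L × T.Rand

/-- The joint law: the `K * L` message symbols are i.i.d. uniform on `F`, and the common randomness
is independent of them. -/
def joint (T : Scheme F K L) : PMF T.Sample :=
  (PMF.uniformOfFintype (Messages F K L)).bind fun w => T.law.map fun s => (w, s)

/-- The random variable `W_k`. -/
def W (T : Scheme F K L) (k : Fin K) : T.Sample → (Fin L → F) := fun ω => ω.1 k

/-- The random variable formed by all the messages except `W_k`. -/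
def WOther (T : Scheme F K L) (k : Fin K) : T.Sample → ({j : Fin K // j ≠ k} → Fin L → F) :=
  fun ω j => ω.1 j

/-- The common randomness `S`. -/
def S (T : Scheme F K L) : T.Sample → T.Rand := fun ω => ω.2

/-- The answer `A_a` of database 1. -/
def A (T : Scheme F K L) (a : Fin T.M₁) : T.Sample → T.AlphA := fun ω => T.ansA a ω.1 ω.2

/-- The answer `B_b` of database 2. -/
def B (T : Scheme F K L) (b : Fin T.M₂) : T.Sample → T.AlphB := fun ω => T.ansB b ω.1 ω.2

/-- The entropy, in symbols of `F`, of a random variable of the scheme. -/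
def H (T : Scheme F K L) {α : Type*} [Fintype α] (X : T.Sample → α) : ℝ :=
  entropy (Fintype.card F) T.joint X

/-- Random reliability: from `A_a` and `B_b` the user decodes the message of index `θ a b`. -/
def RandomReliability (T : Scheme F K L) (θ : Fin T.M₁ → Fin T.M₂ → Fin K) : Prop :=
  ∀ a b, condEntropy (Fintype.card F) T.joint (T.W (θ a b)) (fun ω => (T.A a ω, T.B b ω)) = 0

/-- Database privacy: `A_a` and `B_b` reveal nothing about the other messages. -/
def DatabasePrivacy (T : Scheme F K L) (θ : Fin T.M₁ → Fin T.M₂ → Fin K) : Prop :=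
  ∀ a b, mutualInfo (Fintype.card F) T.joint (T.WOther (θ a b)) (fun ω => (T.A a ω, T.B b ω)) = 0

/-- User privacy: whatever answer one database sends, the index of the decoded message is uniform
on the `K` indices when the answer of the other database is chosen uniformly. -/
def UserPrivacy (T : Scheme F K L) (θ : Fin T.M₁ → Fin T.M₂ → Fin K) : Prop :=
  (∀ a k, ((Finset.univ.filter fun b => θ a b = k).card : ℝ) / T.M₂ = 1 / K) ∧
  (∀ b k, ((Finset.univ.filter fun a => θ a b = k).card : ℝ) / T.M₁ = 1 / K)

/-- A valid scheme for random symmetric private information retrieval. -/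
def Valid (T : Scheme F K L) : Prop :=
  ∃ θ : Fin T.M₁ → Fin T.M₂ → Fin K,
    T.RandomReliability θ ∧ T.DatabasePrivacy θ ∧ T.UserPrivacy θ

/-- The length, in symbols of `F`, of a random variable of the scheme: `log_q` of the number of
values that it takes with positive probability. -/
def length (T : Scheme F K L) {α : Type*} (X : T.Sample → α) : ℝ :=
  Real.logb (Fintype.card F) ((T.joint.map X).support.ncard : ℝ)

/-- The download cost: the largest number of symbols in a pair of answers. -/
def downloadCost (T : Scheme F K L) : ℝ :=
  ⨆ ab : Fin T.M₁ × Fin T.M₂, (T.length (T.A ab.1) + T.length (T.B ab.2))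

/-- The download cost when the transmission of the two answer indices is charged as well. -/
def indexedDownloadCost (T : Scheme F K L) : ℝ :=
  T.downloadCost + Real.logb (Fintype.card F) T.M₁ + Real.logb (Fintype.card F) T.M₂

/-- The download cost when every answer is charged by its entropy only. -/
def entropyDownloadCost (T : Scheme F K L) : ℝ :=
  ⨆ ab : Fin T.M₁ × Fin T.M₂, (T.H (T.A ab.1) + T.H (T.B ab.2))

end Scheme

/-- The retrieval rates `L / D` of all the valid schemes for `K` messages over `F`, of every
message length `L ≥ 1`, where `D` is the given cost of the scheme. -/
def retrievalRates (F : Type u) [Field F] [Fintype F] (K : ℕ)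
    (cost : ∀ L : ℕ, Scheme F K L → ℝ) : Set ℝ :=
  {r | ∃ L : ℕ, 0 < L ∧ ∃ T : Scheme F K L, T.Valid ∧ r = (L : ℝ) / cost L T}

/-- The capacity: the supremum of the retrieval rates over all valid schemes. -/
def capacity (F : Type u) [Field F] [Fintype F] (K : ℕ) : ℝ :=
  sSup (retrievalRates F K fun _ T => T.downloadCost)

end RSPIR

end

namespace RSPIR

/-! ### Shannon inequalities for finitely-valued random variables -/

section Entropy

variable {Ω : Type*} (P : PMF Ω)

/-! The converse is a chain of linear inequalities between joint entropies of answers and messages.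
Privacy makes the other messages independent of a pair of answers, and everything is a function of
messages and randomness, so H(A,B) + (K-1)L ≤ KL + H(S) (`Scheme.H_pair_le_H_S`). Hence a single
bound cL ≤ H(A,B), for some pair, yields both D ≥ cL and H(S) ≥ (c-1)L.

By user privacy every answer helps to retrieve two different messages, which makes it independent of
all messages (`RetrievalProfile.single_eq`). Since A and B together determine one message, H(A,B) is
at least H(A) + L and H(B) + L; with subadditivity this gives 2L. For K ≥ 3 there are a, a', b, b'
such that the message of (a',b) is that of no other pair in this 2×2 block. Supermodularity of U ↦
I(A_a,A_a'; W_U) then forces 6L on the pairs (a,b) and (a',b') together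
(`RetrievalProfile.six_mul_le_pair_add_pair`), so one of them has at least 3L.

The bounds are met by linear schemes with a uniform key: one-time pads arranged in a cyclic Latin
square for K = 2, 3, and a scheme on half-messages for K = 4. Their privacy follows by counting: the
answers have room only for the retrieved message and the key. -/

theorem map_comp_toReal {α β : Type*} [Fintype α] [DecidableEq β] (X : Ω → α) (f : α → β) (y : β) :
    (P.map (fun ω => f (X ω)) y).toReal = ∑ x, if f x = y then (P.map X x).toReal else 0 := by
  have h : P.map (fun ω => f (X ω)) = (P.map X).map f := by
    rw [PMF.map_comp]; rfl
  rw [h, PMF.map_apply, tsum_fintype, ENNReal.toReal_sum]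
  · refine Finset.sum_congr rfl fun x _ => ?_
    by_cases hx : f x = y
    · simp [hx]
    · simp [hx, Ne.symm hx]
  · intro x _
    split_ifs
    · exact PMF.apply_ne_top _ _
    · simp

theorem sum_toReal {α : Type*} [Fintype α] (p : PMF α) : ∑ x, (p x).toReal = 1 := by
  rw [← ENNReal.toReal_sum fun x _ => p.apply_ne_top x, ← tsum_fintype (L := .unconditional α),
    p.tsum_coe, ENNReal.toReal_one]

/-- Expresses the entropies of all functions of `X` as expectations under the one law of `X`, so
that they can be compared term by term. -/
theorem entropy_comp_eq_sum (q : ℝ) {α β : Type*} [Fintype α] [Fintype β] (X : Ω → α) (f : α → β) :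
    entropy q P (fun ω => f (X ω)) =
      (∑ x, (P.map X x).toReal * -Real.log (P.map (fun ω => f (X ω)) (f x)).toReal) /
        Real.log q := by
  classical
  unfold entropy lawEntropy
  rw [← Finset.sum_div]
  congr 1
  calc ∑ y, Real.negMulLog (P.map (fun ω => f (X ω)) y).toReal
      = ∑ y, ∑ x, if f x = y then
          (P.map X x).toReal * -Real.log (P.map (fun ω => f (X ω)) y).toReal else 0 := by
        refine Finset.sum_congr rfl fun y _ => ?_
        rw [Real.negMulLog, neg_mul, ← mul_neg]
        generalize -Real.log _ = c
        rw [map_comp_toReal P X f y, Finset.sum_mul]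
        refine Finset.sum_congr rfl fun x _ => ?_
        split_ifs <;> simp only [zero_mul]
    _ = _ := by
        rw [Finset.sum_comm]
        simp

variable {q : ℝ}

theorem entropy_comp_le (hq : 1 < q) {α β : Type*} [Fintype α] [Fintype β] (X : Ω → α)
    (f : α → β) : entropy q P (fun ω => f (X ω)) ≤ entropy q P X := by
  classical
  have h := entropy_comp_eq_sum P q X id
  simp only [id] at h
  rw [entropy_comp_eq_sum P q X f, h]
  refine div_le_div_of_nonneg_right (Finset.sum_le_sum fun x _ => ?_) (Real.log_pos hq).le
  rcases (ENNReal.toReal_nonneg (a := P.map X x)).eq_or_lt with h0 | h0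
  · rw [← h0, zero_mul, zero_mul]
  · refine mul_le_mul_of_nonneg_left (neg_le_neg (Real.log_le_log h0 ?_)) h0.le
    rw [map_comp_toReal P X f]
    refine le_trans (by simp) (Finset.single_le_sum (f := fun x' =>
      if f x' = f x then (P.map X x').toReal else 0) (fun x' _ => ?_) (Finset.mem_univ x))
    split_ifs
    · exact ENNReal.toReal_nonneg
    · exact le_rfl

/-- Entropy is monotone: a random variable determined by another one has smaller entropy. -/
theorem entropy_mono (hq : 1 < q) {α β : Type*} [Fintype α] [Fintype β] {X : Ω → α} {Y : Ω → β}
    (h : ∀ ω ω', Y ω = Y ω' → X ω = X ω') : entropy q P X ≤ entropy q P Y := by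
  obtain ⟨ω₀, -⟩ := P.support_nonempty
  have : Nonempty α := ⟨X ω₀⟩
  have hX : X = fun ω => Function.extend Y X (fun _ => X ω₀) (Y ω) := by
    funext ω
    exact ((show Function.FactorsThrough X Y from fun a b hab => h a b hab).extend_apply _ ω).symm
  rw [hX]
  exact entropy_comp_le P hq Y _

/-- Entropy depends only on the fibres of a variable; this disposes of all changes of alphabet and
regroupings of tuples. -/
theorem entropy_congr (hq : 1 < q) {α β : Type*} [Fintype α] [Fintype β] {X : Ω → α} {Y : Ω → β}
    (h : ∀ ω ω', Y ω = Y ω' ↔ X ω = X ω') : entropy q P X = entropy q P Y :=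
  le_antisymm (entropy_mono P hq fun _ _ => (h _ _).1) (entropy_mono P hq fun _ _ => (h _ _).2)

/-- Nonnegativity of I(X;Y|Z): log t ≤ t - 1 at t = p(x,z)p(y,z) / (p(z)p(x,y,z)), averaged over p.
The resulting bound is Σ p(x,z)p(y,z)/p(z) - 1 = 0. -/
theorem entropy_submodular (hq : 1 < q) {α β γ : Type*} [Fintype α] [Fintype β] [Fintype γ]
    (X : Ω → α) (Y : Ω → β) (Z : Ω → γ) :
    entropy q P (fun ω => (X ω, Y ω, Z ω)) + entropy q P Z ≤
      entropy q P (fun ω => (X ω, Z ω)) + entropy q P (fun ω => (Y ω, Z ω)) := by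
  classical
  set T : Ω → α × β × γ := fun ω => (X ω, Y ω, Z ω) with hT
  set p : α × β × γ → ℝ := fun t => (P.map T t).toReal with hp
  set pxz : α × γ → ℝ := fun t => (P.map (fun ω => (X ω, Z ω)) t).toReal with hpxz
  set pyz : β × γ → ℝ := fun t => (P.map (fun ω => (Y ω, Z ω)) t).toReal with hpyz
  set pz : γ → ℝ := fun t => (P.map Z t).toReal with hpz
  have e1 := entropy_comp_eq_sum P q T id
  have e2 := entropy_comp_eq_sum P q T fun t => t.2.2
  have e3 := entropy_comp_eq_sum P q T fun t => (t.1, t.2.2)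
  have e4 := entropy_comp_eq_sum P q T fun t => (t.2.1, t.2.2)
  simp only [id] at e1
  change entropy q P T = _ at e1
  change entropy q P Z = (∑ t, p t * -Real.log (pz t.2.2)) / _ at e2
  change entropy q P (fun ω => (X ω, Z ω)) = (∑ t, p t * -Real.log (pxz (t.1, t.2.2))) / _ at e3
  change entropy q P (fun ω => (Y ω, Z ω)) = (∑ t, p t * -Real.log (pyz (t.2.1, t.2.2))) / _ at e4
  rw [e1, e2, e3, e4, ← add_div, ← add_div]
  refine div_le_div_of_nonneg_right ?_ (Real.log_pos hq).le
  rw [← sub_nonpos, ← Finset.sum_add_distrib, ← Finset.sum_add_distrib, ← Finset.sum_sub_distrib]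
  have hpn : ∀ t, 0 ≤ p t := fun t => ENNReal.toReal_nonneg
  have hxzn : ∀ t, 0 ≤ pxz t := fun t => ENNReal.toReal_nonneg
  have hyzn : ∀ t, 0 ≤ pyz t := fun t => ENNReal.toReal_nonneg
  have hzn : ∀ t, 0 ≤ pz t := fun t => ENNReal.toReal_nonneg
  have mxz : ∀ x z, ∑ y, p (x, y, z) = pxz (x, z) := by
    intro x z
    have := map_comp_toReal P T (fun t => (t.1, t.2.2)) (x, z)
    change pxz (x, z) = ∑ t, if (t.1, t.2.2) = (x, z) then p t else 0 at this
    rw [this, Fintype.sum_prod_type]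
    simp only [Fintype.sum_prod_type, Prod.mk.injEq, ite_and]
    simp
  have myz : ∀ y z, ∑ x, p (x, y, z) = pyz (y, z) := by
    intro y z
    have := map_comp_toReal P T (fun t => (t.2.1, t.2.2)) (y, z)
    change pyz (y, z) = ∑ t, if (t.2.1, t.2.2) = (y, z) then p t else 0 at this
    rw [this, Fintype.sum_prod_type]
    simp only [Fintype.sum_prod_type, Prod.mk.injEq, ite_and]
    simp
  have mz : ∀ z, ∑ x, pxz (x, z) = pz z := by
    intro z
    have := map_comp_toReal P (fun ω => (X ω, Z ω)) (fun t => t.2) z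
    change pz z = ∑ t, if t.2 = z then pxz t else 0 at this
    rw [this, Fintype.sum_prod_type]
    simp
  have mz' : ∀ z, ∑ y, pyz (y, z) = pz z := by
    intro z
    have := map_comp_toReal P (fun ω => (Y ω, Z ω)) (fun t => t.2) z
    change pz z = ∑ t, if t.2 = z then pyz t else 0 at this
    rw [this, Fintype.sum_prod_type]
    simp
  have key : ∀ t : α × β × γ, p t * -Real.log (p t) + p t * -Real.log (pz t.2.2) -
      (p t * -Real.log (pxz (t.1, t.2.2)) + p t * -Real.log (pyz (t.2.1, t.2.2))) ≤
      pxz (t.1, t.2.2) * pyz (t.2.1, t.2.2) / pz t.2.2 - p t := by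
    rintro ⟨x, y, z⟩
    dsimp only
    rcases (hpn (x, y, z)).eq_or_lt with h0 | h0
    · rw [← h0]
      simpa using div_nonneg (mul_nonneg (hxzn _) (hyzn _)) (hzn _)
    · have hxz : 0 < pxz (x, z) := lt_of_lt_of_le h0 ((mxz x z) ▸
        Finset.single_le_sum (f := fun y => p (x, y, z)) (fun y _ => hpn _) (Finset.mem_univ y))
      have hyz : 0 < pyz (y, z) := lt_of_lt_of_le h0 ((myz y z) ▸
        Finset.single_le_sum (f := fun x => p (x, y, z)) (fun y _ => hpn _) (Finset.mem_univ x))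
      have hz : 0 < pz z := lt_of_lt_of_le hxz ((mz z) ▸
        Finset.single_le_sum (f := fun x => pxz (x, z)) (fun y _ => hxzn _) (Finset.mem_univ x))
      have hl := Real.log_le_sub_one_of_pos
        (x := pxz (x, z) * pyz (y, z) / (pz z * p (x, y, z))) (by positivity)
      rw [Real.log_div (by positivity) (by positivity), Real.log_mul hxz.ne' hyz.ne',
        Real.log_mul hz.ne' h0.ne'] at hl
      have := mul_le_mul_of_nonneg_left hl h0.le
      calc _ = p (x, y, z) * (Real.log (pxz (x, z)) + Real.log (pyz (y, z)) -
              (Real.log (pz z) + Real.log (p (x, y, z)))) := by ring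
        _ ≤ _ := this
        _ = _ := by field_simp
  refine (Finset.sum_le_sum fun t _ => key t).trans ?_
  rw [Finset.sum_sub_distrib, show ∑ t, p t = 1 from sum_toReal _, sub_nonpos]
  have : ∑ t : α × β × γ, pxz (t.1, t.2.2) * pyz (t.2.1, t.2.2) / pz t.2.2 = ∑ z, pz z := by
    rw [Fintype.sum_prod_type]
    simp only [Fintype.sum_prod_type]
    rw [show ∑ x, ∑ y, ∑ z, pxz (x, z) * pyz (y, z) / pz z =
      ∑ z, ∑ x, ∑ y, pxz (x, z) * pyz (y, z) / pz z by
        rw [Finset.sum_congr rfl fun x _ => Finset.sum_comm, Finset.sum_comm]]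
    refine Finset.sum_congr rfl fun z _ => ?_
    simp_rw [← Finset.sum_div, ← Finset.mul_sum, mz', ← Finset.sum_mul, mz]
    -- If p(z) = 0, the convention x / 0 = 0 gives the right value.
    rcases eq_or_ne (pz z) 0 with h | h
    · simp [h]
    · field_simp
  rw [this]
  exact (sum_toReal (P.map Z)).le

theorem entropy_le_logb_ncard_support (hq : 1 < q) {α : Type*} [Fintype α] (X : Ω → α) :
    entropy q P X ≤ Real.logb q ((P.map X).support.ncard : ℝ) := by
  classical
  unfold entropy lawEntropy Real.logb
  set p := P.map X with hp
  rw [← Finset.sum_div]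
  refine div_le_div_of_nonneg_right ?_ (Real.log_pos hq).le
  set N : ℝ := (p.support.ncard : ℝ) with hN
  have hNpos : 0 < N := by
    rw [hN, Nat.cast_pos]
    exact (Set.ncard_pos (Set.toFinite p.support)).2 p.support_nonempty
  have hcard : ∑ x, (if x ∈ p.support then (1 : ℝ) else 0) = N := by
    rw [Finset.sum_boole, hN, Set.ncard_eq_toFinset_card']
    congr 2
    ext x
    simp
  have key : ∀ x, Real.negMulLog (p x).toReal ≤
      (p x).toReal * Real.log N + ((if x ∈ p.support then (1 : ℝ) else 0) / N - (p x).toReal) := by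
    intro x
    by_cases hx : x ∈ p.support
    · have h0 : 0 < (p x).toReal :=
        ENNReal.toReal_pos ((p.mem_support_iff x).1 hx) (p.apply_ne_top x)
      -- Gibbs' inequality against the uniform law on the support.
      have hl := Real.log_le_sub_one_of_pos (x := 1 / (N * (p x).toReal)) (by positivity)
      rw [Real.log_div one_ne_zero (by positivity), Real.log_mul hNpos.ne' h0.ne',
        Real.log_one] at hl
      have := mul_le_mul_of_nonneg_left hl h0.le
      rw [if_pos hx, Real.negMulLog]
      have e : (p x).toReal * (1 / (N * (p x).toReal) - 1) = 1 / N - (p x).toReal := by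
        field_simp
      linarith
    · have : p x = 0 := by simpa [PMF.mem_support_iff] using hx
      simp [this]
  refine (Finset.sum_le_sum fun x _ => key x).trans ?_
  rw [Finset.sum_add_distrib, Finset.sum_sub_distrib, ← Finset.sum_mul, ← Finset.sum_div, hcard,
    sum_toReal, div_self hNpos.ne']
  simp

theorem entropy_le_logb_card (hq : 1 < q) {α : Type*} [Fintype α] (X : Ω → α) :
    entropy q P X ≤ Real.logb q (Fintype.card α : ℝ) := by
  refine (entropy_le_logb_ncard_support P hq X).trans (Real.logb_le_logb_of_le hq ?_ ?_)
  · have := (Set.ncard_pos (Set.toFinite (P.map X).support)).2 (P.map X).support_nonempty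
    exact_mod_cast this
  · rw [← Nat.card_eq_fintype_card, ← Set.ncard_univ]
    exact_mod_cast Set.ncard_le_ncard (Set.subset_univ _) (Set.toFinite _)

theorem entropy_nonneg (hq : 1 < q) {α : Type*} [Fintype α] (X : Ω → α) : 0 ≤ entropy q P X :=
  Finset.sum_nonneg fun x _ => div_nonneg (Real.negMulLog_nonneg ENNReal.toReal_nonneg
    (by simpa using ENNReal.toReal_mono ENNReal.one_ne_top ((P.map X).coe_le_one x)))
    (Real.log_pos hq).le

theorem entropy_of_subsingleton {α : Type*} [Fintype α] [Subsingleton α] (X : Ω → α) :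
    entropy q P X = 0 := by
  refine Finset.sum_eq_zero fun x _ => ?_
  have h := sum_toReal (P.map X)
  rw [Fintype.sum_subsingleton _ x] at h
  rw [h]
  simp

theorem lawEntropy_uniformOfFintype {α : Type*} [Fintype α] [Nonempty α] :
    lawEntropy q (PMF.uniformOfFintype α) = Real.logb q (Fintype.card α : ℝ) := by
  unfold lawEntropy
  have : (Fintype.card α : ℝ) ≠ 0 := by exact_mod_cast Fintype.card_ne_zero
  simp only [PMF.uniformOfFintype_apply, ENNReal.toReal_inv, ENNReal.toReal_natCast,
    Real.negMulLog, Real.log_inv, Finset.sum_const, Finset.card_univ, nsmul_eq_mul, Real.logb]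
  field_simp

end Entropy

/-! ### Joint entropies of finite subfamilies of a family of random variables -/

section Joint

variable {Ω ι : Type*} {α : ι → Type*} [∀ i, Fintype (α i)]

/-- The joint entropy of the random variables `X i`, `i ∈ U`. -/
noncomputable def jointEntropy (q : ℝ) (P : PMF Ω) (X : ∀ i, Ω → α i) (U : Finset ι) : ℝ := by
  classical
  exact entropy q P fun ω (i : U) => X i ω

variable {q : ℝ} (P : PMF Ω) (X : ∀ i, Ω → α i)

theorem jointEntropy_eq (hq : 1 < q) {β : Type*} [Fintype β] {U : Finset ι} {Y : Ω → β}
    (h : ∀ ω ω', Y ω = Y ω' ↔ ∀ i ∈ U, X i ω = X i ω') :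
    jointEntropy q P X U = entropy q P Y := by
  classical
  refine entropy_congr P hq fun ω ω' => ?_
  rw [h, funext_iff, Subtype.forall]

theorem jointEntropy_mono (hq : 1 < q) {U V : Finset ι} (h : U ⊆ V) :
    jointEntropy q P X U ≤ jointEntropy q P X V := by
  classical
  refine entropy_mono P hq fun ω ω' hω => ?_
  simp only [funext_iff, Subtype.forall] at hω ⊢
  exact fun i hi => hω i (h hi)

theorem jointEntropy_submodular (hq : 1 < q) [DecidableEq ι] (U V : Finset ι) :
    jointEntropy q P X (U ∪ V) + jointEntropy q P X (U ∩ V) ≤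
      jointEntropy q P X U + jointEntropy q P X V := by
  have key := entropy_submodular P hq (fun ω (i : U) => X i ω) (fun ω (i : V) => X i ω)
    (fun ω (i : (U ∩ V : Finset ι)) => X i ω)
  rw [← jointEntropy_eq P X hq (U := U ∪ V), ← jointEntropy_eq P X hq (U := U ∩ V),
    ← jointEntropy_eq P X hq (U := U), ← jointEntropy_eq P X hq (U := V)] at key
  · exact key
  all_goals
    intro ω ω'
    simp only [Prod.mk.injEq, funext_iff, Subtype.forall, Finset.mem_inter, Finset.mem_union]
    try grind

theorem jointEntropy_nonneg (hq : 1 < q) (U : Finset ι) : 0 ≤ jointEntropy q P X U := by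
  classical
  exact entropy_nonneg P hq _

theorem jointEntropy_empty (hq : 1 < q) : jointEntropy q P X ∅ = 0 := by
  rw [jointEntropy_eq P X hq (Y := fun _ => ()) (by simp)]
  exact entropy_of_subsingleton P _

end Joint

end RSPIR

/-! ### The converse inequalities for abstract entropy profiles -/

namespace RSPIR

/-- The Shannon-type constraints satisfied by the joint entropies `g S U` of the answers in `S` and
the messages in `U`, in a scheme in which the answers `a` and `b` reveal the message `θ a b` and
nothing about the other messages. -/
structure RetrievalProfile (I J κ : Type*) [DecidableEq I] [DecidableEq J] [DecidableEq κ]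
    [Fintype κ] where
  /-- the entropy of a message -/
  L : ℝ
  /-- the index of the revealed message -/
  θ : I → J → κ
  /-- the joint entropies -/
  g : Finset (I ⊕ J) → Finset κ → ℝ
  mono : ∀ {S S' U U'}, S ⊆ S' → U ⊆ U' → g S U ≤ g S' U'
  submod : ∀ {S S' S₀ U U' U₀}, S₀ ⊆ S → S₀ ⊆ S' → U₀ ⊆ U → U₀ ⊆ U' →
    g (S ∪ S') (U ∪ U') + g S₀ U₀ ≤ g S U + g S' U'
  msg : ∀ U, g ∅ U = U.card * L
  dec : ∀ a b, g {.inl a, .inr b} {θ a b} ≤ g {.inl a, .inr b} ∅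
  priv : ∀ a b, g {.inl a, .inr b} ∅ + g ∅ {θ a b}ᶜ ≤ g {.inl a, .inr b} {θ a b}ᶜ

namespace RetrievalProfile

variable {I J κ : Type*} [DecidableEq I] [DecidableEq J] [DecidableEq κ] [Fintype κ]
  (R : RetrievalProfile I J κ)

theorem le_add_card_sdiff (S : Finset (I ⊕ J)) {U V : Finset κ} (h : U ⊆ V) :
    R.g S V ≤ R.g S U + ((V.card : ℝ) - U.card) * R.L := by
  have h1 := R.submod (S := S) (S' := ∅) (S₀ := ∅) (U := U) (U' := V \ U) (U₀ := ∅)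
    (by simp) (by simp) (by simp) (by simp)
  rw [R.msg, R.msg, Finset.union_empty, Finset.union_sdiff_of_subset h,
    Finset.cast_card_sdiff h] at h1
  simpa using h1

theorem insert_le {a : I} {b : J} {S : Finset (I ⊕ J)} (ha : .inl a ∈ S) (hb : .inr b ∈ S)
    (U : Finset κ) : R.g S (insert (R.θ a b) U) ≤ R.g S U := by
  have hs : ({.inl a, .inr b} : Finset (I ⊕ J)) ⊆ S := by
    intro n hn
    simp only [Finset.mem_insert, Finset.mem_singleton] at hn
    rcases hn with rfl | rfl <;> assumption
  have h1 := R.submod (S := {.inl a, .inr b}) (S' := S) (S₀ := {.inl a, .inr b})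
    (U := {R.θ a b}) (U' := U) (U₀ := ∅) (by simp) hs (by simp) (by simp)
  rw [Finset.union_eq_right.2 hs, ← Finset.insert_eq] at h1
  linarith [R.dec a b]

theorem pair_univ (a : I) (b : J) : R.g {.inl a, .inr b} ∅ + ((Fintype.card κ : ℝ) - 1) * R.L ≤
    R.g {.inl a, .inr b} Finset.univ := by
  have h1 := R.priv a b
  have h2 : R.g {.inl a, .inr b} {R.θ a b}ᶜ ≤ R.g {.inl a, .inr b} Finset.univ :=
    R.mono (Finset.Subset.refl _) (Finset.subset_univ _)
  rw [R.msg, Finset.card_compl, Finset.card_singleton,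
    Nat.cast_sub (Fintype.card_pos_iff.2 ⟨R.θ a b⟩)] at h1
  simp only [Nat.cast_one] at h1
  linarith

/-- Adjoining the retrieved message costs nothing, and each other message at most `R.L`. By privacy
the total up to all messages attains this maximum, so every intermediate step is tight. -/
theorem pair_eq {a : I} {b : J} {V : Finset κ} (hV : R.θ a b ∈ V) :
    R.g {.inl a, .inr b} V = R.g {.inl a, .inr b} ∅ + ((V.card : ℝ) - 1) * R.L := by
  have h1 := R.le_add_card_sdiff {.inl a, .inr b} (Finset.singleton_subset_iff.2 hV)
  have h2 := R.le_add_card_sdiff {.inl a, .inr b} (Finset.subset_univ V)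
  have h3 := R.pair_univ a b
  have h4 := R.dec a b
  rw [Finset.card_univ] at h2
  rw [Finset.card_singleton, Nat.cast_one] at h1
  linarith

/-- An answer is independent of all the messages, as soon as it serves to retrieve two of them. -/
theorem single_eq {n : I ⊕ J} {a a' : I} {b b' : J}
    (h : n ∈ ({.inl a, .inr b} : Finset (I ⊕ J))) (h' : n ∈ ({.inl a', .inr b'} : Finset (I ⊕ J)))
    (hne : R.θ a b ≠ R.θ a' b') (V : Finset κ) :
    R.g {n} V = R.g {n} ∅ + V.card * R.L := by
  -- Given the message of the pair (a,b), `n` is independent of the remaining ones, because the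
  -- whole pair is.
  have h1 := R.submod (S := {n}) (S' := {.inl a, .inr b}) (S₀ := {n}) (U := Finset.univ)
    (U' := {R.θ a b}) (U₀ := {R.θ a b}) (by simp) (by simpa using h) (by simp) (by simp)
  rw [Finset.union_eq_right.2 (Finset.singleton_subset_iff.2 h), Finset.union_eq_left.2 (Finset.subset_univ _)] at h1
  -- That message itself is hidden by the pair (a',b'), hence independent of `n`.
  have h2 := R.submod (S := {n}) (S' := {.inl a', .inr b'}) (S₀ := {n}) (U := {R.θ a b})
    (U' := ∅) (U₀ := ∅) (by simp) (by simpa using h') (by simp) (by simp)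
  rw [Finset.union_eq_right.2 (Finset.singleton_subset_iff.2 h'), Finset.union_empty] at h2
  have h3 := R.pair_eq (a := a') (b := b') (V := {R.θ a' b', R.θ a b}) (by simp)
  rw [Finset.card_pair hne.symm] at h3
  have h4 := R.insert_le (a := a') (b := b') (S := {.inl a', .inr b'}) (by simp) (by simp)
    {R.θ a b}
  have h5 := R.le_add_card_sdiff {n} (Finset.subset_univ V)
  have h6 := R.le_add_card_sdiff {n} (Finset.empty_subset V)
  have h7 := R.pair_univ a b
  have h8 := R.dec a b
  rw [Finset.card_univ] at h5
  push_cast at h3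
  simp only [Finset.card_empty, Nat.cast_zero] at h6
  linarith

/-- The pair determines its message, of which each answer alone is independent; so the pair exceeds
either answer by `R.L`. Add the two bounds and use subadditivity. -/
theorem two_mul_le_pair {a a' : I} {b b' : J} (ha : R.θ a b ≠ R.θ a b')
    (hb : R.θ a b ≠ R.θ a' b) : 2 * R.L ≤ R.g {.inl a, .inr b} ∅ := by
  have h1 := R.single_eq (n := .inl a) (a := a) (b := b) (a' := a) (b' := b') (by simp) (by simp)
    ha {R.θ a b}
  have h2 := R.single_eq (n := .inr b) (a := a) (b := b) (a' := a') (b' := b) (by simp) (by simp)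
    hb {R.θ a b}
  have h3 := R.submod (S := {.inl a}) (S' := {.inr b}) (S₀ := ∅) (U := ∅) (U' := ∅) (U₀ := ∅)
    (by simp) (by simp) (by simp) (by simp)
  have h4 := R.dec a b
  have h5 : R.g {.inl a} {R.θ a b} ≤ R.g {.inl a, .inr b} {R.θ a b} :=
    R.mono (by simp) (by simp)
  have h6 : R.g {.inr b} {R.θ a b} ≤ R.g {.inl a, .inr b} {R.θ a b} :=
    R.mono (by simp) (by simp)
  have h7 := R.msg ∅
  simp only [Finset.card_empty, Nat.cast_zero, zero_mul, Finset.card_singleton, Nat.cast_one,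
    one_mul, Finset.union_empty] at *
  rw [← Finset.insert_eq] at h3
  linarith

/-- Two answers of the first database and two answers of the second database, such that `a', b`
reveal a message which is revealed by none of the other three pairs: then the pairs `a, b` and
`a', b'` contain at least `6 * L` symbols together. -/
theorem six_mul_le_pair_add_pair {a a' : I} {b b' : J} (h1 : R.θ a' b ≠ R.θ a b)
    (h2 : R.θ a' b ≠ R.θ a b') (h3 : R.θ a' b ≠ R.θ a' b') {a₀ : I}
    (h4 : R.θ a₀ b' ≠ R.θ a' b') (h5 : ∃ b₀, R.θ a b₀ ≠ R.θ a b) :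
    6 * R.L ≤ R.g {.inl a, .inr b} ∅ + R.g {.inl a', .inr b'} ∅ := by
  obtain ⟨b₀, h5⟩ := h5
  set x := R.θ a b with hx
  set y := R.θ a' b with hy
  set z := R.θ a b' with hz
  set t := R.θ a' b' with ht
  set K : ℝ := (Fintype.card κ : ℝ) with hK
  -- Supermodularity of the information in `a, a'` will be applied to `{x, y}`, decodable once `b`
  -- is added, and to `V`, decodable once `b'` is added. They meet in `x` alone. The cardinality of
  -- `V` cancels at the end, so `x`, `z`, `t` may coincide.
  set V : Finset κ := {x, z, t} with hV
  have hxV : x ∈ V := by simp [hV]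
  have hzV : z ∈ V := by simp [hV]
  have htV : t ∈ V := by simp [hV]
  have hyV : y ∉ V := by simp [hV, h1, h2, h3]
  have ca : ∀ U, R.g {.inl a} U = R.g {.inl a} ∅ + U.card * R.L :=
    R.single_eq (a := a) (b := b) (a' := a) (b' := b₀) (by simp) (by simp) h5.symm
  have ca' : ∀ U, R.g {.inl a'} U = R.g {.inl a'} ∅ + U.card * R.L :=
    R.single_eq (a := a') (b := b) (a' := a') (b' := b') (by simp) (by simp) h3
  have cb : ∀ U, R.g {.inr b} U = R.g {.inr b} ∅ + U.card * R.L :=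
    R.single_eq (a := a) (b := b) (a' := a') (b' := b) (by simp) (by simp) h1.symm
  have cb' : ∀ U, R.g {.inr b'} U = R.g {.inr b'} ∅ + U.card * R.L :=
    R.single_eq (a := a₀) (b := b') (a' := a') (b' := b') (by simp) (by simp) h4
  have pab := R.pair_eq (a := a) (b := b) (V := Finset.univ) (by simp)
  have pa'b := R.pair_eq (a := a') (b := b) (V := Finset.univ) (by simp)
  have pab' := R.pair_eq (a := a) (b := b') (V := Finset.univ) (by simp)
  have pa'b' := R.pair_eq (a := a') (b := b') (V := Finset.univ) (by simp)
  have pab'V := R.pair_eq (a := a) (b := b') (V := V) hzV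
  have pa'b'V := R.pair_eq (a := a') (b := b') (V := V) htV
  have caU := ca {x}
  have cbU := cb Finset.univ
  have cb'U := cb' Finset.univ
  have cb'V := cb' V
  have caT := ca Finset.univ
  have ca'T := ca' Finset.univ
  rw [Finset.card_univ, ← hK] at pab pa'b pab' pa'b' cbU cb'U caT ca'T
  rw [Finset.card_singleton, Nat.cast_one] at caU
  -- the answers `a, a'` together with `b`
  have q1 := R.submod (S := {.inl a, .inl a', .inr b}) (S' := {.inl a, .inl a'})
    (S₀ := {.inl a, .inl a'}) (U := {x, y}) (U' := Finset.univ) (U₀ := {x, y})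
    (by grind) (by simp) (by simp) (by simp)
  rw [Finset.union_eq_left.2 (by grind), Finset.union_eq_right.2 (Finset.subset_univ _)] at q1
  have q2 : R.g {.inl a, .inl a', .inr b} {x, y} ≤ R.g {.inl a, .inl a', .inr b} ∅ :=
    (R.insert_le (a := a) (b := b) (by simp) (by simp) _).trans
      (R.insert_le (a := a') (b := b) (by simp) (by simp) ∅)
  -- the answers `a, a'` together with `b'`
  have q3 := R.submod (S := {.inl a, .inl a', .inr b'}) (S' := {.inl a, .inl a'})
    (S₀ := {.inl a, .inl a'}) (U := V) (U' := Finset.univ) (U₀ := V)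
    (by grind) (by simp) (by simp) (by simp)
  rw [Finset.union_eq_left.2 (by grind), Finset.union_eq_right.2 (Finset.subset_univ _)] at q3
  have q4 := R.submod (S := {.inl a, .inr b'}) (S' := {.inl a', .inr b'})
    (S₀ := {.inr b'}) (U := V) (U' := V) (U₀ := V)
    (by simp) (by simp) (by simp) (by simp)
  rw [Finset.union_self, show ({.inl a, .inr b'} ∪ {.inl a', .inr b'} : Finset (I ⊕ J)) =
    {.inl a, .inl a', .inr b'} by grind] at q4
  -- supermodularity of the information about the messages
  have q5 := R.submod (S := {.inl a, .inl a'}) (S' := {.inl a, .inl a'})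
    (S₀ := {.inl a, .inl a'}) (U := {x, y}) (U' := V) (U₀ := {x})
    (by simp) (by simp) (by simp) (by simpa using hxV)
  have hu : ({x, y} ∪ V : Finset κ) = insert y V := by grind
  rw [Finset.union_self, hu] at q5
  have q6 := R.le_add_card_sdiff {.inl a, .inl a'} (Finset.subset_univ (insert y V))
  rw [Finset.card_univ, ← hK, Finset.card_insert_of_notMem hyV] at q6
  push_cast at q6
  -- the dependence between `a'` and `b`
  have q7 := R.submod (S := {.inl a, .inr b}) (S' := {.inl a, .inl a'})
    (S₀ := {.inl a}) (U := {x}) (U' := {x}) (U₀ := {x})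
    (by simp) (by simp) (by simp) (by simp)
  rw [Finset.union_self, show ({.inl a, .inr b} ∪ {.inl a, .inl a'} : Finset (I ⊕ J)) =
    {.inl a, .inl a', .inr b} by grind] at q7
  have q8 : R.g {.inl a, .inl a', .inr b} ∅ ≤ R.g {.inl a, .inl a', .inr b} {x} :=
    R.mono (by simp) (by simp)
  have q9 := R.dec a b
  rw [← hx] at q9
  -- upper bounds
  have u1 : R.g {.inl a, .inl a'} Finset.univ ≤ R.g {.inl a, .inl a', .inr b} Finset.univ :=
    R.mono (by grind) (by simp)
  have u2 : R.g {.inl a, .inl a'} Finset.univ ≤ R.g {.inl a, .inl a', .inr b'} Finset.univ :=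
    R.mono (by grind) (by simp)
  have u3 : R.g {.inl a, .inr b} Finset.univ ≤ R.g {.inl a, .inl a', .inr b} Finset.univ :=
    R.mono (by grind) (by simp)
  have u4 : R.g {.inl a', .inr b'} Finset.univ ≤ R.g {.inl a, .inl a', .inr b'} Finset.univ :=
    R.mono (by grind) (by simp)
  have u5 := R.submod (S := {.inl a}) (S' := {.inr b'}) (S₀ := ∅) (U := ∅) (U' := ∅) (U₀ := ∅)
    (by simp) (by simp) (by simp) (by simp)
  rw [Finset.union_self, ← Finset.insert_eq, R.msg] at u5
  simp only [Finset.card_empty, Nat.cast_zero, zero_mul] at u5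
  -- Let P be the sum of the two pair entropies and Q = g(a,a',b) + g(a,a',b') - g(a,a'), all taken
  -- with every message adjoined. The inequalities `q1`–`q9` and `u5` combine to (4-K)L + Q ≤ P. By
  -- `u1`–`u4`, Q is at least either pair entropy plus (K-1)L; averaging, Q ≥ P/2 + (K-1)L, whence P
  -- ≥ 6L.
  linarith

end RetrievalProfile
end RSPIR

/-! ### Entropy profiles of valid schemes, and the converse -/

namespace RSPIR

theorem one_lt_card_field (F : Type u) [Field F] [Fintype F] : (1 : ℝ) < (Fintype.card F : ℝ) := by
  exact_mod_cast Fintype.one_lt_card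

theorem logb_card_pow (F : Type u) [Field F] [Fintype F] (n : ℕ) :
    Real.logb (Fintype.card F) ((Fintype.card F : ℝ) ^ n) = n := by
  have := one_lt_card_field F
  rw [← Real.rpow_natCast, Real.logb_rpow (by positivity) this.ne']

set_option linter.unusedSectionVars false

namespace Scheme

variable {F : Type u} [Field F] [Fintype F] {K L : ℕ} (T : Scheme F K L)

theorem map_messages_joint : T.joint.map Prod.fst = PMF.uniformOfFintype (Messages F K L) := by
  have h : ∀ w : Messages F K L, (T.law.map fun s => (w, s)).map Prod.fst = PMF.pure w := by
    intro w
    rw [PMF.map_comp]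
    exact PMF.map_const _ _
  rw [joint, PMF.map_bind]
  simp only [h, PMF.bind_pure]

theorem map_S_joint : T.joint.map T.S = T.law := by
  have h : ∀ w : Messages F K L, (T.law.map fun s => (w, s)).map T.S = T.law := by
    intro w
    rw [PMF.map_comp]
    exact PMF.map_id _
  rw [joint, PMF.map_bind]
  simp only [h, PMF.bind_const]

theorem H_messages : T.H (fun ω => ω.1) = K * L := by
  unfold H entropy
  rw [show (fun ω : T.Sample => ω.1) = Prod.fst from rfl, map_messages_joint,
    lawEntropy_uniformOfFintype]
  simp only [Messages, Fintype.card_fun, Fintype.card_fin, Nat.cast_pow, ← pow_mul]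
  rw [logb_card_pow]
  push_cast
  ring

/-- The alphabets of the answers and of the messages. -/
def Val (T : Scheme F K L) : (Fin T.M₁ ⊕ Fin T.M₂) ⊕ Fin K → Type u
  | .inl (.inl _) => T.AlphA
  | .inl (.inr _) => T.AlphB
  | .inr _ => Fin L → F

instance instFintypeVal : ∀ i, Fintype (T.Val i)
  | .inl (.inl _) => T.fintypeAlphA
  | .inl (.inr _) => T.fintypeAlphB
  | .inr _ => (inferInstance : Fintype (Fin L → F))

/-- The family of all the answers and all the messages. -/
def var (T : Scheme F K L) : ∀ i, T.Sample → T.Val i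
  | .inl (.inl a) => T.A a
  | .inl (.inr b) => T.B b
  | .inr k => T.W k

/-- The joint entropy of the answers in `S` and of the messages in `U`. -/
noncomputable def answerEntropy (T : Scheme F K L) (S : Finset (Fin T.M₁ ⊕ Fin T.M₂))
    (U : Finset (Fin K)) : ℝ :=
  jointEntropy (Fintype.card F) T.joint T.var (S.disjSum U)

theorem answerEntropy_eq {β : Type*} [Fintype β] {S : Finset (Fin T.M₁ ⊕ Fin T.M₂)}
    {U : Finset (Fin K)} {Y : T.Sample → β}
    (h : ∀ ω ω', Y ω = Y ω' ↔ (∀ a, .inl a ∈ S → T.A a ω = T.A a ω') ∧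
      (∀ b, .inr b ∈ S → T.B b ω = T.B b ω') ∧ ∀ k ∈ U, T.W k ω = T.W k ω') :
    T.answerEntropy S U = T.H Y := by
  refine jointEntropy_eq T.joint T.var (one_lt_card_field F) fun ω ω' => ?_
  rw [h]
  simp only [Sum.forall, Finset.inl_mem_disjSum, Finset.inr_mem_disjSum, and_assoc]
  rfl

theorem answerEntropy_mono {S S' : Finset (Fin T.M₁ ⊕ Fin T.M₂)} {U U' : Finset (Fin K)}
    (hS : S ⊆ S') (hU : U ⊆ U') : T.answerEntropy S U ≤ T.answerEntropy S' U' :=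
  jointEntropy_mono T.joint T.var (one_lt_card_field F) (Finset.disjSum_mono hS hU)

/-- By monotonicity the intersections may be replaced by smaller sets; no intersection then has to
be computed, whichever indices coincide. -/
theorem answerEntropy_submod {S S' S₀ : Finset (Fin T.M₁ ⊕ Fin T.M₂)} {U U' U₀ : Finset (Fin K)}
    (hS : S₀ ⊆ S) (hS' : S₀ ⊆ S') (hU : U₀ ⊆ U) (hU' : U₀ ⊆ U') :
    T.answerEntropy (S ∪ S') (U ∪ U') + T.answerEntropy S₀ U₀ ≤
      T.answerEntropy S U + T.answerEntropy S' U' := by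
  have h := jointEntropy_submodular T.joint T.var (one_lt_card_field F) (S.disjSum U)
    (S'.disjSum U')
  have h1 : S.disjSum U ∪ S'.disjSum U' = (S ∪ S').disjSum (U ∪ U') := by
    ext (i | i) <;> simp
  rw [h1] at h
  have h2 : T.answerEntropy S₀ U₀ ≤
      jointEntropy (Fintype.card F) T.joint T.var (S.disjSum U ∩ S'.disjSum U') :=
    jointEntropy_mono T.joint T.var (one_lt_card_field F)
      (Finset.subset_inter (Finset.disjSum_mono hS hU) (Finset.disjSum_mono hS' hU'))
  unfold answerEntropy at *
  linarith

theorem H_W_le (k : Fin K) : T.H (T.W k) ≤ L := by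
  refine (entropy_le_logb_card T.joint (one_lt_card_field F) (T.W k)).trans_eq ?_
  simp only [Fintype.card_fun, Fintype.card_fin, Nat.cast_pow]
  exact logb_card_pow F L

theorem answerEntropy_empty_le (U : Finset (Fin K)) : T.answerEntropy ∅ U ≤ U.card * L := by
  induction U using Finset.induction_on with
  | empty =>
    rw [answerEntropy, Finset.disjSum_empty, Finset.map_empty,
      jointEntropy_empty T.joint T.var (one_lt_card_field F)]
    simp
  | insert k U hk ih =>
    have h := T.answerEntropy_submod (S := ∅) (S' := ∅) (S₀ := ∅) (U := {k}) (U' := U) (U₀ := ∅)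
      (by simp) (by simp) (by simp) (by simp)
    have h0 : 0 ≤ T.answerEntropy ∅ ∅ := jointEntropy_nonneg _ _ (one_lt_card_field F) _
    have h1 : T.answerEntropy ∅ {k} = T.H (T.W k) := T.answerEntropy_eq (by simp)
    rw [Finset.union_self, ← Finset.insert_eq] at h
    rw [Finset.card_insert_of_notMem hk]
    push_cast
    linarith [T.H_W_le k]

/-- The lower bound comes from the total K * L minus the upper bound for the complement. -/
theorem answerEntropy_empty (U : Finset (Fin K)) : T.answerEntropy ∅ U = U.card * L := by
  refine le_antisymm (T.answerEntropy_empty_le U) ?_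
  have h := T.answerEntropy_submod (S := ∅) (S' := ∅) (S₀ := ∅) (U := U) (U' := Uᶜ) (U₀ := ∅)
    (by simp) (by simp) (by simp) (by simp)
  have h0 : 0 ≤ T.answerEntropy ∅ ∅ := jointEntropy_nonneg _ _ (one_lt_card_field F) _
  have h1 := T.answerEntropy_empty_le Uᶜ
  have h2 : T.answerEntropy ∅ Finset.univ = T.H (fun ω => ω.1) :=
    T.answerEntropy_eq fun ω ω' => by simp [W, funext_iff]
  rw [Finset.union_self, Finset.union_compl, h2, H_messages] at h
  rw [Finset.card_compl, Fintype.card_fin,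
    Nat.cast_sub (by simpa using Finset.card_le_univ U)] at h1
  linarith

theorem answerEntropy_pair (a : Fin T.M₁) (b : Fin T.M₂) :
    T.answerEntropy {.inl a, .inr b} ∅ = T.H (fun ω => (T.A a ω, T.B b ω)) :=
  T.answerEntropy_eq (by simp)

theorem answerEntropy_pair_singleton (a : Fin T.M₁) (b : Fin T.M₂) (k : Fin K) :
    T.answerEntropy {.inl a, .inr b} {k} = T.H (fun ω => (T.W k ω, T.A a ω, T.B b ω)) :=
  T.answerEntropy_eq (by simp; grind)

theorem forall_mem_compl_iff (k : Fin K) (ω ω' : T.Sample) :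
    (∀ j ∈ ({k}ᶜ : Finset (Fin K)), T.W j ω = T.W j ω') ↔ T.WOther k ω = T.WOther k ω' := by
  simp [WOther, W, funext_iff]

theorem answerEntropy_compl (k : Fin K) : T.answerEntropy ∅ {k}ᶜ = T.H (T.WOther k) :=
  T.answerEntropy_eq fun ω ω' => by rw [forall_mem_compl_iff]; simp

theorem answerEntropy_pair_compl (a : Fin T.M₁) (b : Fin T.M₂) (k : Fin K) :
    T.answerEntropy {.inl a, .inr b} {k}ᶜ =
      T.H (fun ω => (T.WOther k ω, T.A a ω, T.B b ω)) :=
  T.answerEntropy_eq fun ω ω' => by rw [forall_mem_compl_iff]; simp; grind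

variable {T}

/-- The joint entropies of a valid scheme. -/
noncomputable def profile {θ : Fin T.M₁ → Fin T.M₂ → Fin K} (hr : T.RandomReliability θ)
    (hp : T.DatabasePrivacy θ) : RetrievalProfile (Fin T.M₁) (Fin T.M₂) (Fin K) where
  L := L
  θ := θ
  g := T.answerEntropy
  mono := T.answerEntropy_mono
  submod := T.answerEntropy_submod
  msg := T.answerEntropy_empty
  dec a b := by
    have h := hr a b
    unfold condEntropy at h
    rw [answerEntropy_pair_singleton, answerEntropy_pair]
    unfold H
    linarith
  priv a b := by
    have h := hp a b
    unfold mutualInfo at h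
    rw [answerEntropy_pair_compl, answerEntropy_pair, answerEntropy_compl]
    unfold H
    linarith

/-- The answers and all the messages are functions of messages and randomness, so their joint
entropy is at most K * L + H(S); by privacy it is at least H(A,B) + (K - 1) * L. -/
theorem H_pair_le_H_S {θ : Fin T.M₁ → Fin T.M₂ → Fin K} (hr : T.RandomReliability θ)
    (hp : T.DatabasePrivacy θ) (a : Fin T.M₁) (b : Fin T.M₂) :
    T.H (fun ω => (T.A a ω, T.B b ω)) ≤ L + T.H T.S := by
  have h1 := (profile hr hp).pair_univ a b
  change T.answerEntropy {.inl a, .inr b} ∅ + ((Fintype.card (Fin K) : ℝ) - 1) * (L : ℝ) ≤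
    T.answerEntropy {.inl a, .inr b} Finset.univ at h1
  rw [answerEntropy_pair, Fintype.card_fin] at h1
  have h2 : T.answerEntropy {.inl a, .inr b} Finset.univ =
      T.H (fun ω => ((T.A a ω, T.B b ω), ω.1)) :=
    T.answerEntropy_eq fun ω ω' => by simp [W, funext_iff, and_assoc]
  have h3 : T.H (fun ω => ((T.A a ω, T.B b ω), ω.1)) ≤ T.H (fun ω => (ω.1, T.S ω, ())) := by
    refine entropy_mono T.joint (one_lt_card_field F) fun ω ω' h => ?_
    obtain rfl : ω = ω' := Prod.ext (Prod.mk.inj h).1 (Prod.mk.inj (Prod.mk.inj h).2).1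
    rfl
  have h4 := entropy_submodular T.joint (one_lt_card_field F) (fun ω => ω.1) T.S (fun _ => ())
  have h5 : 0 ≤ entropy (Fintype.card F) T.joint (fun _ => ()) :=
    entropy_nonneg T.joint (one_lt_card_field F) _
  have h6 : entropy (Fintype.card F) T.joint (fun ω => (ω.1, ())) = T.H (fun ω => ω.1) :=
    entropy_congr T.joint (one_lt_card_field F) (by simp)
  have h7 : entropy (Fintype.card F) T.joint (fun ω => (T.S ω, ())) = T.H T.S :=
    entropy_congr T.joint (one_lt_card_field F) (by simp)
  have h8 := T.H_messages
  unfold H at *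
  linarith

theorem H_pair_le (a : Fin T.M₁) (b : Fin T.M₂) :
    T.H (fun ω => (T.A a ω, T.B b ω)) ≤ T.H (T.A a) + T.H (T.B b) := by
  have h := T.answerEntropy_submod (S := {.inl a}) (S' := {.inr b}) (S₀ := ∅) (U := ∅) (U' := ∅)
    (U₀ := ∅) (by simp) (by simp) (by simp) (by simp)
  rw [Finset.union_self, ← Finset.insert_eq, answerEntropy_pair, answerEntropy_empty,
    T.answerEntropy_eq (S := {.inl a}) (Y := T.A a) (by simp),
    T.answerEntropy_eq (S := {.inr b}) (Y := T.B b) (by simp)] at h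
  simpa using h

theorem H_pair_le_entropyDownloadCost (a : Fin T.M₁) (b : Fin T.M₂) :
    T.H (fun ω => (T.A a ω, T.B b ω)) ≤ T.entropyDownloadCost :=
  (H_pair_le a b).trans (le_ciSup
    (f := fun ab : Fin T.M₁ × Fin T.M₂ => T.H (T.A ab.1) + T.H (T.B ab.2))
    (Set.finite_range _).bddAbove (a, b))

variable (T)

theorem entropyDownloadCost_le_downloadCost : T.entropyDownloadCost ≤ T.downloadCost := by
  refine ciSup_mono (Set.finite_range _).bddAbove fun ab => add_le_add ?_ ?_
  all_goals exact entropy_le_logb_ncard_support T.joint (one_lt_card_field F) _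

theorem downloadCost_le_indexedDownloadCost : T.downloadCost ≤ T.indexedDownloadCost := by
  unfold indexedDownloadCost
  have h1 : 0 ≤ Real.logb (Fintype.card F) (T.M₁ : ℝ) :=
    Real.logb_nonneg (one_lt_card_field F) (by exact_mod_cast T.M₁_pos)
  have h2 : 0 ≤ Real.logb (Fintype.card F) (T.M₂ : ℝ) :=
    Real.logb_nonneg (one_lt_card_field F) (by exact_mod_cast T.M₂_pos)
  linarith

variable {T}

theorem UserPrivacy.exists_eq_right {θ : Fin T.M₁ → Fin T.M₂ → Fin K} (h : T.UserPrivacy θ)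
    (a : Fin T.M₁) (k : Fin K) : ∃ b, θ a b = k := by
  by_contra! hne
  have h1 := h.1 a k
  rw [Finset.filter_false_of_mem fun b _ => hne b] at h1
  have : (0 : ℝ) < K := by exact_mod_cast k.pos
  simp at h1
  linarith

theorem UserPrivacy.exists_eq_left {θ : Fin T.M₁ → Fin T.M₂ → Fin K} (h : T.UserPrivacy θ)
    (b : Fin T.M₂) (k : Fin K) : ∃ a, θ a b = k := by
  by_contra! hne
  have h1 := h.2 b k
  rw [Finset.filter_false_of_mem fun a _ => hne a] at h1
  have : (0 : ℝ) < K := by exact_mod_cast k.pos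
  simp at h1
  linarith

/-- For at least three messages, two answers of one database leave room for an answer of the other
one which retrieves a prescribed message with neither of them. -/
theorem UserPrivacy.exists_ne_ne {θ : Fin T.M₁ → Fin T.M₂ → Fin K} (h : T.UserPrivacy θ)
    (hK : 3 ≤ K) (a a' : Fin T.M₁) (k : Fin K) : ∃ b, θ a b ≠ k ∧ θ a' b ≠ k := by
  by_contra! hne
  have h1 := h.1 a k
  have h2 := h.1 a' k
  have hM : (0 : ℝ) < T.M₂ := by exact_mod_cast T.M₂_pos
  have hK' : (3 : ℝ) ≤ K := by exact_mod_cast hK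
  have hc : (T.M₂ : ℝ) ≤ ((Finset.univ.filter fun b => θ a b = k).card : ℝ) +
      ((Finset.univ.filter fun b => θ a' b = k).card : ℝ) := by
    have hu : (Finset.univ : Finset (Fin T.M₂)) =
        (Finset.univ.filter fun b => θ a b = k) ∪ (Finset.univ.filter fun b => θ a' b = k) := by
      ext b
      have := hne b
      simp only [Finset.mem_univ, Finset.mem_union, Finset.mem_filter, true_and]
      tauto
    have hle := Finset.card_union_le (Finset.univ.filter fun b => θ a b = k)
      (Finset.univ.filter fun b => θ a' b = k)
    rw [← hu, Finset.card_univ, Fintype.card_fin] at hle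
    exact_mod_cast hle
  rw [div_eq_div_iff (by positivity) (by positivity)] at h1 h2
  nlinarith

/-- In a valid scheme for at least two messages some pair of answers has entropy at least `2 * L`. -/
theorem Valid.exists_two_mul_le (hT : T.Valid) (hK : 2 ≤ K) :
    ∃ a b, 2 * (L : ℝ) ≤ T.H (fun ω => (T.A a ω, T.B b ω)) ∧
      T.H (fun ω => (T.A a ω, T.B b ω)) ≤ L + T.H T.S := by
  obtain ⟨θ, hr, hp, hu⟩ := hT
  let k₀ : Fin K := ⟨0, by omega⟩
  let k₁ : Fin K := ⟨1, by omega⟩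
  have hk : k₀ ≠ k₁ := by simp [k₀, k₁]
  let a : Fin T.M₁ := ⟨0, T.M₁_pos⟩
  obtain ⟨b, hb⟩ := hu.exists_eq_right a k₀
  obtain ⟨b', hb'⟩ := hu.exists_eq_right a k₁
  obtain ⟨a', ha'⟩ := hu.exists_eq_left b k₁
  refine ⟨a, b, ?_, H_pair_le_H_S hr hp a b⟩
  rw [← answerEntropy_pair]
  exact (profile hr hp).two_mul_le_pair (a := a) (b := b) (a' := a') (b' := b')
    (by change θ a b ≠ θ a b'; rw [hb, hb']; exact hk)
    (by change θ a b ≠ θ a' b; rw [hb, ha']; exact hk)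

/-- In a valid scheme for at least three messages some pair of answers has entropy at least
`3 * L`. -/
theorem Valid.exists_three_mul_le (hT : T.Valid) (hK : 3 ≤ K) :
    ∃ a b, 3 * (L : ℝ) ≤ T.H (fun ω => (T.A a ω, T.B b ω)) ∧
      T.H (fun ω => (T.A a ω, T.B b ω)) ≤ L + T.H T.S := by
  obtain ⟨θ, hr, hp, hu⟩ := hT
  let x : Fin K := ⟨0, by omega⟩
  let y : Fin K := ⟨1, by omega⟩
  have hxy : y ≠ x := by simp [x, y]
  let b : Fin T.M₂ := ⟨0, T.M₂_pos⟩
  obtain ⟨a, ha⟩ := hu.exists_eq_left b x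
  obtain ⟨a', ha'⟩ := hu.exists_eq_left b y
  obtain ⟨b', hb, hb'⟩ := hu.exists_ne_ne hK a a' y
  -- `a₀` and `b₀` serve only to let `b'` and `a` retrieve a second message, hence be independent of
  -- all messages.
  obtain ⟨a₀, ha₀⟩ := hu.exists_eq_left b' y
  obtain ⟨b₀, hb₀⟩ := hu.exists_eq_right a y
  have h := (profile hr hp).six_mul_le_pair_add_pair (a := a) (a' := a') (b := b) (b' := b')
    (a₀ := a₀) (by change θ a' b ≠ θ a b; rw [ha, ha']; exact hxy)
    (by change θ a' b ≠ θ a b'; rw [ha']; exact hb.symm)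
    (by change θ a' b ≠ θ a' b'; rw [ha']; exact hb'.symm)
    (by change θ a₀ b' ≠ θ a' b'; rw [ha₀]; exact hb'.symm)
    ⟨b₀, by change θ a b₀ ≠ θ a b; rw [ha, hb₀]; exact hxy⟩
  change 6 * (L : ℝ) ≤ T.answerEntropy _ _ + T.answerEntropy _ _ at h
  rw [answerEntropy_pair, answerEntropy_pair] at h
  rcases le_total (3 * (L : ℝ)) (T.H (fun ω => (T.A a ω, T.B b ω))) with h3 | h3
  · exact ⟨a, b, h3, H_pair_le_H_S hr hp a b⟩
  · exact ⟨a', b', by linarith, H_pair_le_H_S hr hp a' b'⟩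

end Scheme
end RSPIR

/-! ### Criteria for validity, and the cyclic scheme -/

namespace RSPIR

set_option linter.unusedSectionVars false

namespace Scheme

variable {F : Type u} [Field F] [Fintype F] {K L : ℕ} {T : Scheme F K L}

theorem joint_eq_uniformOfFintype [Nonempty T.Rand]
    (hlaw : T.law = PMF.uniformOfFintype T.Rand) :
    T.joint = PMF.uniformOfFintype T.Sample := by
  classical
  ext ⟨w, s⟩
  simp only [joint, hlaw, PMF.bind_apply, PMF.map_apply, PMF.uniformOfFintype_apply,
    tsum_fintype, Prod.mk.injEq, ite_and, Finset.sum_ite_irrel, Finset.sum_ite_eq,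
    Finset.mem_univ, if_true, Finset.sum_const_zero, mul_ite, mul_zero, Fintype.card_prod,
    Nat.cast_mul]
  exact (ENNReal.mul_inv (Or.inr (ENNReal.natCast_ne_top _))
    (Or.inl (ENNReal.natCast_ne_top _))).symm

theorem H_S_of_uniform [Nonempty T.Rand] (hlaw : T.law = PMF.uniformOfFintype T.Rand) {r : ℕ}
    (hr : Fintype.card T.Rand = Fintype.card F ^ r) : T.H T.S = r := by
  unfold H entropy
  rw [map_S_joint, hlaw, lawEntropy_uniformOfFintype, hr, Nat.cast_pow, logb_card_pow]

theorem H_id_of_uniform [Nonempty T.Rand] (hlaw : T.law = PMF.uniformOfFintype T.Rand) {r : ℕ}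
    (hr : Fintype.card T.Rand = Fintype.card F ^ r) :
    T.H (fun ω : T.Sample => ω) = K * L + r := by
  unfold H entropy
  rw [show (fun ω : T.Sample => ω) = id from rfl, PMF.map_id, joint_eq_uniformOfFintype hlaw,
    lawEntropy_uniformOfFintype, Fintype.card_prod, hr]
  simp only [Messages, Fintype.card_fun, Fintype.card_fin, ← pow_mul, ← pow_add]
  rw [Nat.cast_pow, logb_card_pow]
  push_cast
  ring

theorem length_le {α : Type*} [Fintype α] (X : T.Sample → α) {n : ℕ}
    (hn : Fintype.card α = Fintype.card F ^ n) : T.length X ≤ n := by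
  rw [← logb_card_pow F n, ← Nat.cast_pow, ← hn, length]
  refine Real.logb_le_logb_of_le (one_lt_card_field F) ?_ ?_
  · have := (Set.ncard_pos (Set.toFinite (T.joint.map X).support)).2
      (T.joint.map X).support_nonempty
    exact_mod_cast this
  · rw [← Nat.card_eq_fintype_card, ← Set.ncard_univ]
    exact_mod_cast Set.ncard_le_ncard (Set.subset_univ _) (Set.toFinite _)

theorem downloadCost_le {i j : ℕ} (hA : Fintype.card T.AlphA = Fintype.card F ^ i)
    (hB : Fintype.card T.AlphB = Fintype.card F ^ j) : T.downloadCost ≤ i + j := by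
  have : Nonempty (Fin T.M₁ × Fin T.M₂) := ⟨⟨0, T.M₁_pos⟩, ⟨0, T.M₂_pos⟩⟩
  exact ciSup_le fun ab => add_le_add (length_le _ hA) (length_le _ hB)

theorem randomReliability_of_determined {θ : Fin T.M₁ → Fin T.M₂ → Fin K}
    (hdec : ∀ a b w s w' s', T.ansA a w s = T.ansA a w' s' → T.ansB b w s = T.ansB b w' s' →
      w (θ a b) = w' (θ a b)) : T.RandomReliability θ := by
  intro a b
  rw [condEntropy, sub_eq_zero]
  refine entropy_congr T.joint (one_lt_card_field F) fun ω ω' => ?_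
  simp only [Prod.mk.injEq]
  exact ⟨fun h => ⟨hdec a b _ _ _ _ h.1 h.2, h⟩, fun h => h.2⟩

/-- If the answers determine one message, and together with the messages the common randomness,
then database privacy holds as soon as the answers have the least possible length. -/
theorem databasePrivacy_of_determined {θ : Fin T.M₁ → Fin T.M₂ → Fin K}
    (hdec : ∀ a b w s w' s', T.ansA a w s = T.ansA a w' s' → T.ansB b w s = T.ansB b w' s' →
      w (θ a b) = w' (θ a b))
    (hrand : ∀ a b w s s', T.ansA a w s = T.ansA a w s' → T.ansB b w s = T.ansB b w s' → s = s')
    [Nonempty T.Rand] (hlaw : T.law = PMF.uniformOfFintype T.Rand) {r i j : ℕ}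
    (hr : Fintype.card T.Rand = Fintype.card F ^ r)
    (hA : Fintype.card T.AlphA = Fintype.card F ^ i)
    (hB : Fintype.card T.AlphB = Fintype.card F ^ j) (hij : i + j = L + r) :
    T.DatabasePrivacy θ := by
  intro a b
  have h1 : T.H (T.WOther (θ a b)) = ((K : ℝ) - 1) * L := by
    rw [← answerEntropy_compl, answerEntropy_empty, Finset.card_compl, Fintype.card_fin,
      Finset.card_singleton, Nat.cast_sub (θ a b).pos, Nat.cast_one]
  have h2 : T.H (fun ω => (T.A a ω, T.B b ω)) ≤ L + r := by
    refine (entropy_le_logb_card T.joint (one_lt_card_field F) _).trans_eq ?_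
    rw [Fintype.card_prod, hA, hB, ← pow_add, hij, Nat.cast_pow, logb_card_pow, Nat.cast_add]
  have h3 : T.H (fun ω => (T.WOther (θ a b) ω, (T.A a ω, T.B b ω))) = K * L + r := by
    rw [← H_id_of_uniform hlaw hr]
    refine entropy_congr T.joint (one_lt_card_field F) fun ω ω' => ⟨fun h => by rw [h], ?_⟩
    rintro h
    simp only [Prod.mk.injEq] at h
    obtain ⟨hw, hA, hB⟩ := h
    obtain ⟨w, s⟩ := ω
    obtain ⟨w', s'⟩ := ω'
    obtain rfl : w = w' := by
      funext k
      by_cases hk : k = θ a b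
      · rw [hk]
        exact hdec a b w s w' s' hA hB
      · exact congrFun hw ⟨k, hk⟩
    rw [hrand a b w s s' hA hB]
  -- This is I ≥ 0, while `h1`, `h2`, `h3` give I ≤ (K-1)L + (L+r) - (KL+r) = 0.
  have h4 := T.answerEntropy_submod (S := ∅) (S' := {.inl a, .inr b}) (S₀ := ∅) (U := {θ a b}ᶜ)
    (U' := ∅) (U₀ := ∅) (by simp) (by simp) (by simp) (by simp)
  rw [Finset.empty_union, Finset.union_empty, answerEntropy_pair_compl, answerEntropy_compl,
    answerEntropy_pair, answerEntropy_empty, Finset.card_empty] at h4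
  unfold H at *
  unfold mutualInfo
  push_cast at h4
  linarith

/-- The case where `θ` is a Latin square of order `K`. -/
theorem userPrivacy_of_bijective {θ : Fin T.M₁ → Fin T.M₂ → Fin K} (h₁ : T.M₁ = K) (h₂ : T.M₂ = K)
    (ha : ∀ a, Function.Bijective (θ a)) (hb : ∀ b, Function.Bijective fun a => θ a b) :
    T.UserPrivacy θ := by
  constructor
  · intro a k
    obtain ⟨b, hb⟩ := (ha a).2 k
    have : (Finset.univ.filter fun b => θ a b = k) = {b} := by
      ext b'
      simpa [← hb] using (ha a).1.eq_iff
    rw [this, Finset.card_singleton, h₂, Nat.cast_one]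
  · intro b k
    obtain ⟨a, ha⟩ := (hb b).2 k
    have : (Finset.univ.filter fun a => θ a b = k) = {a} := by
      ext a'
      simpa [← ha] using (hb b).1.eq_iff (a := a') (b := a)
    rw [this, Finset.card_singleton, h₁, Nat.cast_one]

end Scheme

/-! ### A scheme of rate `1 / K` -/

section Cyclic

variable (F : Type u) [Field F] [Fintype F] (n L : ℕ)

/-- The scheme for `n + 1` messages in which database 1 sends either one of `n` keys or the negated
sum of all the keys and messages, and database 2 sends `n` messages, encrypted with the keys. -/
noncomputable def cyclicScheme : Scheme F (n + 1) L where
  Rand := Fin n → Fin L → F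
  law := PMF.uniformOfFintype _
  M₁ := n + 1
  M₂ := n + 1
  M₁_pos := n.succ_pos
  M₂_pos := n.succ_pos
  AlphA := Fin L → F
  AlphB := Fin n → Fin L → F
  ansA a w s := Fin.snoc (α := fun _ => Fin L → F) s (-(∑ i, s i + ∑ k, w k)) a
  ansB b w s i := s i + w (i.castSucc + b)

instance : Nonempty (cyclicScheme F n L).Rand := ⟨fun _ _ => (0 : F)⟩

theorem cyclicScheme_spec : (cyclicScheme F n L).Valid ∧
    (cyclicScheme F n L).downloadCost ≤ (n + 1 : ℝ) * L ∧
    (cyclicScheme F n L).H (cyclicScheme F n L).S = n * L := by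
  have hR : Fintype.card (cyclicScheme F n L).Rand = Fintype.card F ^ (n * L) := by
    change Fintype.card (Fin n → Fin L → F) = _
    simp [← pow_mul, mul_comm]
  have hA : Fintype.card (cyclicScheme F n L).AlphA = Fintype.card F ^ L := by
    change Fintype.card (Fin L → F) = _
    simp
  have hdec : ∀ (a b : Fin (n + 1)) (w : Messages F (n + 1) L) s w' s',
      (cyclicScheme F n L).ansA a w s = (cyclicScheme F n L).ansA a w' s' →
      (cyclicScheme F n L).ansB b w s = (cyclicScheme F n L).ansB b w' s' →
      w (a + b) = w' (a + b) := by
    intro a b w s w' s' h1 h2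
    dsimp only [cyclicScheme] at s s' h1 h2
    have h2' : ∀ i, s i + w (i.castSucc + b) = s' i + w' (i.castSucc + b) := congrFun h2
    induction a using Fin.lastCases with
    | cast i =>
      rw [Fin.snoc_castSucc, Fin.snoc_castSucc] at h1
      have := h2' i
      rw [h1] at this
      exact add_left_cancel this
    | last =>
      rw [Fin.snoc_last, Fin.snoc_last, neg_inj] at h1
      -- The ciphertexts carry every message but the one of index `Fin.last n + b`; subtracting
      -- their sum from the total of keys and messages leaves exactly that one.
      have key : ∀ v : Messages F (n + 1) L,
          ∑ k, v k = ∑ i : Fin n, v (i.castSucc + b) + v (Fin.last n + b) := by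
        intro v
        rw [← Fin.sum_univ_castSucc fun k => v (k + b)]
        exact (Equiv.sum_comp (Equiv.addRight b) v).symm
      have h3 := Finset.sum_congr (s₁ := Finset.univ) rfl fun i _ => h2' i
      rw [Finset.sum_add_distrib, Finset.sum_add_distrib] at h3
      rw [key, key, ← add_assoc, ← add_assoc, h3] at h1
      exact add_left_cancel h1
  have hrand : ∀ (a b : Fin (n + 1)) (w : Messages F (n + 1) L) s s',
      (cyclicScheme F n L).ansA a w s = (cyclicScheme F n L).ansA a w s' →
      (cyclicScheme F n L).ansB b w s = (cyclicScheme F n L).ansB b w s' → s = s' := by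
    intro a b w s s' _ h2
    dsimp only [cyclicScheme] at s s' h2
    funext i
    exact add_right_cancel (congrFun h2 i)
  refine ⟨⟨show Fin (n + 1) → Fin (n + 1) → Fin (n + 1) from fun a b => a + b,
    Scheme.randomReliability_of_determined hdec,
    Scheme.databasePrivacy_of_determined hdec hrand rfl hR hA hR rfl,
    Scheme.userPrivacy_of_bijective rfl rfl
      (fun a => (Equiv.addLeft (show Fin (n + 1) from a)).bijective)
      fun b => (Equiv.addRight (show Fin (n + 1) from b)).bijective⟩, ?_, ?_⟩
  · refine (Scheme.downloadCost_le hA hR).trans_eq ?_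
    push_cast
    ring
  · rw [Scheme.H_S_of_uniform rfl hR]
    push_cast
    ring

end Cyclic

end RSPIR

/-! ### The scheme for four messages -/

namespace RSPIR

section Root

variable {G : Type*} [CommRing G]

/-- The answers of database 1 in the scheme for four messages `(x k, y k)`. Up to the choice of
coordinates, answer `a` is the class of a translate of the key `s` modulo a root `f a` of a root
system of type `D₄`, the answers of database 2 are classes modulo the roots `g b`, and `f` and `g`
are two orthogonal frames. -/
def rootAnswerA (a : Fin 4) (x y s : Fin 4 → G) : Fin 3 → G :=
  (![![s 0 + s 1 + s 2 + x 0 + y 1 + y 2, s 0 + s 1 + s 3 + y 0 + x 1 + y 3,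
       s 0 + s 2 + s 3 + x 2 + x 3],
     ![s 0 + y 2 + y 3, s 2 - y 3, s 3 - y 2],
     ![s 0 + y 0 + y 1 + x 3, s 1 - x 3, s 3 - y 1],
     ![s 0 + x 0 + x 1 + x 2, s 1 - x 2, s 2 - x 1]] : Fin 4 → Fin 3 → G) a

/-- The answers of database 2 in the scheme for four messages `(x k, y k)`. -/
def rootAnswerB (b : Fin 4) (x y s : Fin 4 → G) : Fin 3 → G :=
  (![![s 1 - x 2 - x 3, s 2 - x 1 - y 3, s 3 - y 1 - y 2],
     ![s 1, s 0 + s 2 + x 0 + y 2, s 0 + s 3 + y 0 + y 3],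
     ![s 2, s 0 + s 1 + x 0 + y 1, s 0 + s 3 + x 3],
     ![s 3, s 0 + s 1 + y 0 + x 1, s 0 + s 2 + x 2]] : Fin 4 → Fin 3 → G) b

/-- The index of the message retrieved from the answers `a` and `b`. -/
def rootIndex (a b : Fin 4) : Fin 4 :=
  (![![0, 1, 2, 3], ![1, 0, 3, 2], ![2, 3, 0, 1], ![3, 2, 1, 0]] : Fin 4 → Fin 4 → Fin 4) a b

theorem rootIndex_bijective_left : ∀ a, Function.Bijective (rootIndex a) := by
  decide

theorem rootIndex_bijective_right : ∀ b, Function.Bijective fun a => rootIndex a b := by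
  decide

theorem rootAnswer_decode (a b : Fin 4) {x y s x' y' s' : Fin 4 → G}
    (hA : rootAnswerA a x y s = rootAnswerA a x' y' s')
    (hB : rootAnswerB b x y s = rootAnswerB b x' y' s') :
    x (rootIndex a b) = x' (rootIndex a b) ∧ y (rootIndex a b) = y' (rootIndex a b) := by
  have a0 := congrFun hA 0
  have a1 := congrFun hA 1
  have a2 := congrFun hA 2
  have b0 := congrFun hB 0
  have b1 := congrFun hB 1
  have b2 := congrFun hB 2
  clear hA hB
  fin_cases a <;> fin_cases b <;>
    simp [rootAnswerA, rootAnswerB, rootIndex] at a0 a1 a2 b0 b1 b2 ⊢ <;> grind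

/-- The key is known modulo `f a` and modulo `g b`, and these two vectors are independent in every
characteristic. -/
theorem rootAnswer_key (a b : Fin 4) {x y s s' : Fin 4 → G}
    (hA : rootAnswerA a x y s = rootAnswerA a x y s')
    (hB : rootAnswerB b x y s = rootAnswerB b x y s') : s = s' := by
  have a0 := congrFun hA 0
  have a1 := congrFun hA 1
  have a2 := congrFun hA 2
  have b0 := congrFun hB 0
  have b1 := congrFun hB 1
  have b2 := congrFun hB 2
  clear hA hB
  suffices s 0 = s' 0 ∧ s 1 = s' 1 ∧ s 2 = s' 2 ∧ s 3 = s' 3 by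
    funext i
    fin_cases i <;> simp [this]
  fin_cases a <;> fin_cases b <;>
    simp [rootAnswerA, rootAnswerB] at a0 a1 a2 b0 b1 b2 ⊢ <;> grind

end Root

/-- The two halves of a string of `2 * m` symbols. -/
def half {F : Type*} {m : ℕ} (j : Fin 2) (v : Fin (2 * m) → F) : Fin m → F :=
  fun i => v (finProdFinEquiv (j, i))

theorem half_ext {F : Type*} {m : ℕ} {v v' : Fin (2 * m) → F} (h₀ : half 0 v = half 0 v')
    (h₁ : half 1 v = half 1 v') : v = v' := by
  funext i
  obtain ⟨⟨j, i⟩, rfl⟩ := finProdFinEquiv.surjective i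
  fin_cases j
  · exact congrFun h₀ i
  · exact congrFun h₁ i

variable (F : Type u) [Field F] [Fintype F] (m : ℕ)

/-- A scheme of rate `1 / 3` for four messages. -/
noncomputable def rootScheme : Scheme F 4 (2 * m) where
  Rand := Fin 4 → Fin m → F
  law := PMF.uniformOfFintype _
  M₁ := 4
  M₂ := 4
  M₁_pos := by norm_num
  M₂_pos := by norm_num
  AlphA := Fin 3 → Fin m → F
  AlphB := Fin 3 → Fin m → F
  ansA a w s := rootAnswerA a (fun k => half 0 (w k)) (fun k => half 1 (w k)) s
  ansB b w s := rootAnswerB b (fun k => half 0 (w k)) (fun k => half 1 (w k)) s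

instance : Nonempty (rootScheme F m).Rand := ⟨fun _ _ => (0 : F)⟩

theorem rootScheme_spec : (rootScheme F m).Valid ∧
    (rootScheme F m).downloadCost ≤ 6 * m ∧ (rootScheme F m).H (rootScheme F m).S = 4 * m := by
  have hR : Fintype.card (rootScheme F m).Rand = Fintype.card F ^ (4 * m) := by
    change Fintype.card (Fin 4 → Fin m → F) = _
    simp [← pow_mul, mul_comm]
  have hA : Fintype.card (rootScheme F m).AlphA = Fintype.card F ^ (3 * m) := by
    change Fintype.card (Fin 3 → Fin m → F) = _
    simp [← pow_mul, mul_comm]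
  have hB : Fintype.card (rootScheme F m).AlphB = Fintype.card F ^ (3 * m) := hA
  have hdec : ∀ (a b : Fin 4) (w : Messages F 4 (2 * m)) s w' s',
      (rootScheme F m).ansA a w s = (rootScheme F m).ansA a w' s' →
      (rootScheme F m).ansB b w s = (rootScheme F m).ansB b w' s' →
      w (rootIndex a b) = w' (rootIndex a b) := by
    intro a b w s w' s' h1 h2
    have h := rootAnswer_decode (G := Fin m → F) a b
      (x := fun k => half 0 (w k)) (y := fun k => half 1 (w k)) (s := s)
      (x' := fun k => half 0 (w' k)) (y' := fun k => half 1 (w' k)) (s' := s') h1 h2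
    exact half_ext h.1 h.2
  have hrand : ∀ (a b : Fin 4) (w : Messages F 4 (2 * m)) s s',
      (rootScheme F m).ansA a w s = (rootScheme F m).ansA a w s' →
      (rootScheme F m).ansB b w s = (rootScheme F m).ansB b w s' → s = s' :=
    fun a b w s s' h1 h2 => rootAnswer_key (G := Fin m → F) a b (x := fun k => half 0 (w k))
      (y := fun k => half 1 (w k)) (s := s) (s' := s') h1 h2
  refine ⟨⟨rootIndex, Scheme.randomReliability_of_determined hdec,
    Scheme.databasePrivacy_of_determined hdec hrand rfl hR hA hB (by ring),
    Scheme.userPrivacy_of_bijective rfl rfl rootIndex_bijective_left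
      rootIndex_bijective_right⟩, ?_, ?_⟩
  · refine (Scheme.downloadCost_le hA hB).trans_eq ?_
    push_cast
    ring
  · rw [Scheme.H_S_of_uniform rfl hR]
    push_cast
    ring

end RSPIR

/-! ### From the bounds and the schemes to the capacity -/

namespace RSPIR

open Filter Topology

variable {F : Type u} [Field F] [Fintype F] {K : ℕ}

theorem isGreatest_retrievalRates {cost : ∀ L : ℕ, Scheme F K L → ℝ} {c : ℝ} (hc : 0 < c)
    (hlow : ∀ L : ℕ, ∀ T : Scheme F K L, T.Valid → c * L ≤ cost L T) {L : ℕ} (hL : 0 < L)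
    {T : Scheme F K L} (hT : T.Valid) (hle : cost L T ≤ c * L) :
    IsGreatest (retrievalRates F K cost) (1 / c) := by
  have hL' : (0 : ℝ) < L := by exact_mod_cast hL
  refine ⟨⟨L, hL, T, hT, ?_⟩, ?_⟩
  · rw [le_antisymm hle (hlow L T hT)]
    field_simp
  · rintro r ⟨L, hL, T, hT, rfl⟩
    have hL' : (0 : ℝ) < L := by exact_mod_cast hL
    have h := hlow L T hT
    rw [div_le_div_iff₀ (lt_of_lt_of_le (by positivity) h) hc]
    linarith

/-- The indices cost 2 log_q K whatever the message length, so their share vanishes as the length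
grows. -/
theorem isLUB_retrievalRates_indexed {c : ℝ} (hc : 0 < c)
    (hlow : ∀ L : ℕ, ∀ T : Scheme F K L, T.Valid → c * L ≤ T.downloadCost) {ℓ : ℕ} (hℓ : 0 < ℓ)
    (hach : ∀ n : ℕ, ∃ T : Scheme F K (ℓ * n), T.Valid ∧ T.downloadCost ≤ c * (ℓ * n : ℕ) ∧
      T.M₁ = K ∧ T.M₂ = K) :
    IsLUB (retrievalRates F K fun _ T => T.indexedDownloadCost) (1 / c) := by
  refine ⟨?_, fun u hu => ?_⟩
  · rintro r ⟨L, hL, T, hT, rfl⟩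
    have hL' : (0 : ℝ) < L := by exact_mod_cast hL
    have h := (hlow L T hT).trans T.downloadCost_le_indexedDownloadCost
    rw [div_le_div_iff₀ (lt_of_lt_of_le (by positivity) h) hc]
    linarith
  · set d := Real.logb (Fintype.card F) K + Real.logb (Fintype.card F) K with hd
    have hlim : Tendsto (fun n : ℕ => 1 / (c + d / ((ℓ * n : ℕ) : ℝ))) atTop (𝓝 (1 / c)) := by
      have h1 : Tendsto (fun n : ℕ => ((ℓ * n : ℕ) : ℝ)) atTop atTop :=
        tendsto_natCast_atTop_atTop.comp (tendsto_id.const_mul_atTop' hℓ)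
      have h2 := (h1.const_div_atTop d).const_add c
      rw [add_zero] at h2
      exact tendsto_const_nhds.div h2 hc.ne'
    refine le_of_tendsto hlim ((eventually_gt_atTop 0).mono fun n hn => hu ?_)
    obtain ⟨T, hT, hD, h1, h2⟩ := hach n
    have hL : 0 < ℓ * n := Nat.mul_pos hℓ hn
    have hL' : (0 : ℝ) < (ℓ * n : ℕ) := by exact_mod_cast hL
    refine ⟨ℓ * n, hL, T, hT, ?_⟩
    dsimp only
    rw [Scheme.indexedDownloadCost, le_antisymm hD (hlow _ T hT), h1, h2, add_assoc, ← hd]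
    field_simp

/-- The converse and the achievability part determine all the suprema of the rates and the least
amount of common randomness. -/
theorem capacity_and_randomness {c : ℝ} (hc : 0 < c) {ℓ : ℕ} (hℓ : 0 < ℓ)
    (hconv : ∀ L : ℕ, ∀ T : Scheme F K L, T.Valid → ∃ a b,
      c * L ≤ T.H (fun ω => (T.A a ω, T.B b ω)) ∧
      T.H (fun ω => (T.A a ω, T.B b ω)) ≤ L + T.H T.S)
    (hach : ∀ n : ℕ, ∃ T : Scheme F K (ℓ * n), T.Valid ∧ T.downloadCost ≤ c * (ℓ * n : ℕ) ∧
      T.H T.S = (c - 1) * (ℓ * n : ℕ) ∧ T.M₁ = K ∧ T.M₂ = K) :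
    (capacity F K = 1 / c ∧ IsLUB (retrievalRates F K fun _ T => T.downloadCost) (1 / c)) ∧
    IsLUB (retrievalRates F K fun _ T => T.indexedDownloadCost) (1 / c) ∧
    IsLUB (retrievalRates F K fun _ T => T.entropyDownloadCost) (1 / c) ∧
    (∀ L : ℕ, 0 < L → ∀ T : Scheme F K L, T.Valid → (c - 1) * L ≤ T.H T.S) ∧
    (∀ L : ℕ, 0 < L → ℓ ∣ L → ∃ T : Scheme F K L,
      T.Valid ∧ (L : ℝ) / T.downloadCost = 1 / c ∧ T.H T.S = (c - 1) * L) := by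
  have hent : ∀ L : ℕ, ∀ T : Scheme F K L, T.Valid → c * L ≤ T.entropyDownloadCost := by
    intro L T hT
    obtain ⟨a, b, h, -⟩ := hconv L T hT
    exact h.trans (Scheme.H_pair_le_entropyDownloadCost a b)
  have hdown : ∀ L : ℕ, ∀ T : Scheme F K L, T.Valid → c * L ≤ T.downloadCost := fun L T hT =>
    (hent L T hT).trans T.entropyDownloadCost_le_downloadCost
  obtain ⟨T, hT, hD, -⟩ := hach 1
  have hg := isGreatest_retrievalRates hc hdown (by omega) hT hD
  refine ⟨⟨hg.csSup_eq, hg.isLUB⟩, ?_, ?_, ?_, ?_⟩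
  · refine isLUB_retrievalRates_indexed hc hdown hℓ fun n => ?_
    obtain ⟨T, hT, hD, -, h⟩ := hach n
    exact ⟨T, hT, hD, h⟩
  · exact (isGreatest_retrievalRates hc hent (by omega) hT
      (T.entropyDownloadCost_le_downloadCost.trans hD)).isLUB
  · intro L _ T hT
    obtain ⟨a, b, h1, h2⟩ := hconv L T hT
    linarith
  · rintro L hL ⟨n, rfl⟩
    obtain ⟨T, hT, hD, hS, -⟩ := hach n
    have hL' : (0 : ℝ) < (ℓ * n : ℕ) := by exact_mod_cast hL
    refine ⟨T, hT, ?_, hS⟩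
    rw [le_antisymm hD (hdown _ T hT)]
    field_simp

end RSPIR

theorem theorem3 {F : Type u} [Field F] [Fintype F] (K : ℕ) (C ρ : ℝ) (ℓ : ℕ)
    (hK : (K = 2 ∧ C = 1 / 2 ∧ ρ = 1 ∧ ℓ = 1) ∨
          (K = 3 ∧ C = 1 / 3 ∧ ρ = 2 ∧ ℓ = 1) ∨
          (K = 4 ∧ C = 1 / 3 ∧ ρ = 2 ∧ ℓ = 2)) :
    -- the capacity, the supremum being a genuine least upper bound
    (RSPIR.capacity F K = C ∧
      IsLUB (RSPIR.retrievalRates F K fun _ T => T.downloadCost) C) ∧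
    -- it does not change if the answer indices are charged too, or only the entropies are charged
    IsLUB (RSPIR.retrievalRates F K fun _ T => T.indexedDownloadCost) C ∧
    IsLUB (RSPIR.retrievalRates F K fun _ T => T.entropyDownloadCost) C ∧
    -- every valid scheme needs common randomness of entropy at least `ρ * L`
    (∀ L : ℕ, 0 < L → ∀ T : RSPIR.Scheme F K L, T.Valid → ρ * L ≤ T.H T.S) ∧
    -- this amount is attained, by valid schemes that attain the capacity
    (∀ L : ℕ, 0 < L → ℓ ∣ L → ∃ T : RSPIR.Scheme F K L,
      T.Valid ∧ (L : ℝ) / T.downloadCost = C ∧ T.H T.S = ρ * L) := by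
  rcases hK with ⟨rfl, rfl, rfl, rfl⟩ | ⟨rfl, rfl, rfl, rfl⟩ | ⟨rfl, rfl, rfl, rfl⟩
  -- Here c = 2 and ρ = c - 1. The first rewriting also affects the numerator of 1 / 2, which the
  -- second restores.
  · rw [show (1 : ℝ) = 2 - 1 by norm_num, show (2 - 1 : ℝ) / 2 = 1 / 2 by norm_num]
    refine RSPIR.capacity_and_randomness two_pos one_pos
      (fun L T hT => hT.exists_two_mul_le le_rfl) fun n => ?_
    obtain ⟨h1, h2, h3⟩ := RSPIR.cyclicScheme_spec F 1 (1 * n)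
    refine ⟨RSPIR.cyclicScheme F 1 (1 * n), h1, h2.trans_eq (by norm_num), ?_, rfl, rfl⟩
    rw [h3]
    norm_num
  · rw [show (2 : ℝ) = 3 - 1 by norm_num]
    refine RSPIR.capacity_and_randomness three_pos one_pos
      (fun L T hT => hT.exists_three_mul_le le_rfl) fun n => ?_
    obtain ⟨h1, h2, h3⟩ := RSPIR.cyclicScheme_spec F 2 (1 * n)
    refine ⟨RSPIR.cyclicScheme F 2 (1 * n), h1, h2.trans_eq (by norm_num), ?_, rfl, rfl⟩
    rw [h3]
    norm_num
  · rw [show (2 : ℝ) = 3 - 1 by norm_num]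
    refine RSPIR.capacity_and_randomness three_pos two_pos
      (fun L T hT => hT.exists_three_mul_le (by norm_num)) fun n => ?_
    obtain ⟨h1, h2, h3⟩ := RSPIR.rootScheme_spec F n
    refine ⟨RSPIR.rootScheme F n, h1, h2.trans_eq ?_, ?_, rfl, rfl⟩
    · push_cast
      ring
    · rw [h3]
      push_cast
      ring
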